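/- Let $\mathcal G$ be a connected, locally finite metric graph with countable vertex set and edge set, each edge $e$ being identified with an interval $[a_e,b_e]$ of finite positive length. Let $\partial\mathcal G$ be a set of vertices containing all vertices of degree $1$; the other vertices are called interior. Let $\overline{\mathcal G}$ be the completion of $\mathcal G$ for the geodesic distance, and let $\partial\overline{\mathcal G}=\overline{\mathcal G}\setminus(\mathcal G\setminus\partial\mathcal G)$. Assume that $\overline{\mathcal G}$ is compact and that $\partial\overline{\mathcal G}$ is totally disconnected. For $A\subset\partial\overline{\mathcal G}$ and $\epsilon>0$ let $N_\epsilon(A)$ be the union of the open balls in $\overline{\mathcal G}$ of radius $\epsilon$ centered at points of $A$. Let $L^2(\mathcal G)=\bigoplus_e L^2[a_e,b_e]$ be the real Hilbert space. Let $\mathcal D_{max}$ be the set of continuous functions $f:\mathcal G\to\mathbb R$ that have an absolutely continuous derivative on each edge, with $f,f''\in L^2(\mathcal G)$, and that satisfy at each interior vertex $v$ the condition $\sum_{e\sim v}\partial_\nu f_e(v)=0$, where $\partial_\nu f_e(v)$ is the derivative of $f_e$ at $v$ in the direction from $v$ into $e$. A function $h$ is harmonic on an open set $U\subset\overline{\mathcal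 G}$ if it is continuous on $U$, satisfies $h''=0$ on the parts of the edges in $U$, and satisfies the same vertex condition at the interior vertices in $U$. Let $\mathcal E(0)=\{E_{0},E_1,\dots,E_{N}\}$ be a finite partition of $\partial\overline{\mathcal G}$ by nonempty clopen sets, where $E_0$ may also be absent (empty). Suppose that for some $\delta>0$ the neighborhoods $N_\delta(E_{n})$ are pairwise disjoint, and have finite volume for $n=1,\dots,N$. For $n=1,\dots,N$ let $h_n$ be a function that is harmonic on $N_\delta(E_n)$ and belongs to $L^2(N_\delta(E_n))$; assign $h_n$ to $E_n$. Given $\mathcal E(j)$, form $\mathcal E(j+1)$ by splitting each member of $\mathcal E(j)$ into two disjoint nonempty clopen sets, or keeping it unchanged if it cannot be split; each part of a set inherits the function assigned to that set. Denote by $\mathcal H(j)$ the resulting assignment of functions to the members of $\mathcal E(j)$ contained in $E_1\cup\dots\cup E_N$. Let $\mathcal D_{\mathcal E(j),\mathcal H(j)}$ be the set of $\phi\in\mathcal D_{max}$ for which there is an $\epsilon$ with $0<\epsilon<\delta$ such that (i) $\phi=0$ on $\mathcal G\cap N_\epsilon(A)$ for each member $A\subset E_0$ of $\mathcal E(j)$,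 and (ii) for each other member $A$ of $\mathcal E(j)$, with assigned function $h_n$, there is a constant $c$ with $\phi=c\,h_n$ on $\mathcal G\cap N_\epsilon(A)$. Let $S_{\mathcal E(j),\mathcal H(j)}$ be the operator $-D^2$ on $L^2(\mathcal G)$ with domain $\mathcal D_{\mathcal E(j),\mathcal H(j)}$, and let $S_U$ be the operator $-D^2$ with domain $\bigcup_j\mathcal D_{\mathcal E(j),\mathcal H(j)}$. Then each of the operators $S_{\mathcal E(j),\mathcal H(j)}$, $j=0,1,2,\dots$, and $S_U$ is symmetric (densely defined, with $\langle Sf,g\rangle=\langle f,Sg\rangle$ for all $f,g$ in its domain), and each of them has a self-adjoint extension on $L^2(\mathcal G)$. -/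

import Mathlib

open MeasureTheory Set

noncomputable section

/-- A connected, locally finite metric graph with vertex set `V` and edge set `E`. The edge `e` is
identified with the interval `[0, len e]`, with `0` at `src e` and `len e` at `tgt e`. A pair
`(e, b) : E × Bool` is an end of the edge `e`: the end at `src e` for `b = false`, the end at
`tgt e` for `b = true`. The boundary vertices `bdry` include all vertices of degree one. -/
structure MetricGraph (V E : Type*) where
  src : E → V
  tgt : E → V
  len : E → ℝ
  bdry : Set V
  len_pos : ∀ e, 0 < len e
  nonempty : Nonempty V
  connected : ∀ v w, Relation.EqvGen (fun a b => ∃ e, src e = a ∧ tgt e = b) v w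
  finite_ends : ∀ v, {d : E × Bool | cond d.2 (tgt d.1) (src d.1) = v}.Finite
  bdry_of_degree_one :
    ∀ v, {d : E × Bool | cond d.2 (tgt d.1) (src d.1) = v}.ncard = 1 → v ∈ bdry

namespace MetricGraph

variable {V E : Type*}

/-- The points of the metric graph: its vertices and the interior points of its edges. -/
inductive Point (G : MetricGraph V E) : Type _
  | vertex (v : V) : Point G
  | inner (e : E) (t : ℝ) (ht : t ∈ Ioo 0 (G.len e)) : Point G

variable (G : MetricGraph V E)

/-- The point with coordinate `t ∈ [0, len e]` on the edge `e`. -/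
def pt (e : E) (t : ℝ) : G.Point :=
  open Classical in
  if h : t ∈ Ioo 0 (G.len e) then .inner e t h
  else if t ≤ 0 then .vertex (G.src e) else .vertex (G.tgt e)

theorem pt_of_mem {e : E} {t : ℝ} (h : t ∈ Ioo 0 (G.len e)) : G.pt e t = .inner e t h := by
  simp [pt, h]

theorem pt_zero (e : E) : G.pt e 0 = .vertex (G.src e) := by
  simp [pt]

theorem pt_len (e : E) : G.pt e (G.len e) = .vertex (G.tgt e) := by
  simp [pt, G.len_pos e]

/-- `G.HasPath x y L`: there is a path of length `L` from `x` to `y`, that is, a finite succession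
of segments of edges, each starting where the preceding one ends. -/
inductive HasPath : G.Point → G.Point → ℝ → Prop
  | nil (x : G.Point) : HasPath x x 0
  | cons (e : E) (s t : ℝ) (hs : s ∈ Icc 0 (G.len e)) (ht : t ∈ Icc 0 (G.len e))
      (y : G.Point) (L : ℝ) (h : HasPath (G.pt e t) y L) : HasPath (G.pt e s) y (|s - t| + L)

variable {G}

theorem HasPath.nonneg {x y : G.Point} {L : ℝ} (h : G.HasPath x y L) : 0 ≤ L := by
  induction h with
  | nil x => exact le_rfl
  | cons e s t hs ht y L h ih => positivity

theorem HasPath.trans {x y z : G.Point} {L M : ℝ} (h : G.HasPath x y L) (h' : G.HasPath y z M) :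
    G.HasPath x z (L + M) := by
  induction h with
  | nil x => simpa using h'
  | cons e s t hs ht y L h ih =>
    rw [add_assoc]
    exact .cons e s t hs ht z _ (ih h')

theorem HasPath.single (e : E) {s t : ℝ} (hs : s ∈ Icc 0 (G.len e)) (ht : t ∈ Icc 0 (G.len e)) :
    G.HasPath (G.pt e s) (G.pt e t) |s - t| := by
  simpa using HasPath.cons e s t hs ht _ 0 (.nil _)

theorem HasPath.symm {x y : G.Point} {L : ℝ} (h : G.HasPath x y L) : G.HasPath y x L := by
  induction h with
  | nil x => exact .nil x
  | cons e s t hs ht y L h ih =>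
    have := ih.trans (HasPath.single e ht hs)
    rwa [abs_sub_comm, add_comm] at this

theorem exists_hasPath_vertex (v w : V) : ∃ L, G.HasPath (.vertex v) (.vertex w) L := by
  induction G.connected v w with
  | rel a b h =>
    obtain ⟨e, rfl, rfl⟩ := h
    have := HasPath.single (G := G) e (left_mem_Icc.2 (G.len_pos e).le)
      (right_mem_Icc.2 (G.len_pos e).le)
    rw [pt_zero, pt_len] at this
    exact ⟨_, this⟩
  | refl a => exact ⟨0, .nil _⟩
  | symm a b _ ih => exact ⟨_, ih.choose_spec.symm⟩
  | trans a b c _ _ ih₁ ih₂ => exact ⟨_, ih₁.choose_spec.trans ih₂.choose_spec⟩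

theorem exists_hasPath (x y : G.Point) : ∃ L, G.HasPath x y L := by
  have key : ∀ x : G.Point, ∃ v L, G.HasPath x (.vertex v) L := by
    rintro (v | ⟨e, t, ht⟩)
    · exact ⟨v, 0, .nil _⟩
    · have := HasPath.single (G := G) e (Ioo_subset_Icc_self ht)
        (left_mem_Icc.2 (G.len_pos e).le)
      rw [pt_zero, pt_of_mem G ht] at this
      exact ⟨_, _, this⟩
  obtain ⟨v, L, h⟩ := key x
  obtain ⟨w, M, h'⟩ := key y
  obtain ⟨K, h''⟩ := exists_hasPath_vertex (G := G) v w
  exact ⟨_, (h.trans h'').trans h'.symm⟩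

/-- The geodesic distance: the infimum of the lengths of the paths joining two points. (As the graph
is locally finite, it separates points; the completion below does not need that fact.) -/
instance : PseudoMetricSpace G.Point where
  dist x y := sInf {L | G.HasPath x y L}
  dist_self x := le_antisymm (csInf_le ⟨0, fun _ h => h.nonneg⟩ (.nil x))
    (Real.sInf_nonneg fun _ h => h.nonneg)
  dist_comm x y := congrArg sInf (Set.ext fun _ => ⟨HasPath.symm, HasPath.symm⟩)
  dist_triangle x y z := by
    rw [← sub_le_iff_le_add]
    refine le_csInf (exists_hasPath x y) fun L hL => ?_
    rw [sub_le_iff_le_add, ← sub_le_iff_le_add']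
    refine le_csInf (exists_hasPath y z) fun M hM => ?_
    rw [sub_le_iff_le_add']
    exact csInf_le ⟨0, fun _ h => h.nonneg⟩ (HasPath.trans hL hM)

variable (G) in
/-- The metric completion of the graph. -/
abbrev Cpl : Type _ := UniformSpace.Completion G.Point

variable (G) in
/-- The boundary of the completion: the complement of the interior of the graph, which consists of
all points of the graph except the boundary vertices. -/
def boundary : Set G.Cpl :=
  ((fun x : G.Point => (x : G.Cpl)) '' {x | ∀ v ∈ G.bdry, x ≠ .vertex v})ᶜ

/-- The neighborhood `N_ε(A)` in the completion of a set `A` of boundary points: the union of the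
open balls of radius `ε` centered at the points of `A`. -/
def nbhd (ε : ℝ) (A : Set G.boundary) : Set G.Cpl :=
  Metric.thickening ε (Subtype.val '' A)

/-- A set is measurable if its trace on each edge is. -/
instance : MeasurableSpace G.Point where
  MeasurableSet' s := ∀ e, MeasurableSet (G.pt e ⁻¹' s)
  measurableSet_empty _ := by simp
  measurableSet_compl s hs e := (hs e).compl
  measurableSet_iUnion s hs e := by
    rw [preimage_iUnion]
    exact .iUnion fun i => hs i e

theorem measurable_pt (e : E) : Measurable (G.pt e) := fun _ hs => hs e

variable (G) in
/-- Lebesgue measure on the graph: the sum of the Lebesgue measures of the edges. -/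
def vol : Measure G.Point :=
  Measure.sum fun e => (volume.restrict (Ioo 0 (G.len e))).map (G.pt e)

variable (G) in
/-- The real Hilbert space `L²(G)`. -/
abbrev L2 : Type _ := Lp ℝ 2 G.vol

/-- The component of a function on the edge `e`. -/
def comp (f : G.Point → ℝ) (e : E) (t : ℝ) : ℝ := f (G.pt e t)

/-- The derivative of a function along the edge `e`, one-sided at the ends of the edge. -/
def edgeDeriv (f : G.Point → ℝ) (e : E) (t : ℝ) : ℝ :=
  derivWithin (comp f e) (Icc 0 (G.len e)) t

/-- The derivative of a function at an end of an edge, pointing from the vertex into the edge. -/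
def outDeriv (f : G.Point → ℝ) (d : E × Bool) : ℝ :=
  cond d.2 (-edgeDeriv f d.1 (G.len d.1)) (edgeDeriv f d.1 0)

/-- The vertex condition at `v`: the derivatives of `f` at `v`, pointing into the edges incident on
`v`, add up to zero. -/
def Kirchhoff (f : G.Point → ℝ) (v : V) : Prop :=
  ∑ d ∈ (G.finite_ends v).toFinset, outDeriv f d = 0

/-- The second derivative `D² f` on the open edges (the vertices form a null set). -/
def D2 (f : G.Point → ℝ) : G.Point → ℝ
  | .vertex _ => 0
  | .inner e t _ => deriv (edgeDeriv f e) t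

/-- Membership in `𝒟_max`. -/
structure IsDmax (f : G.Point → ℝ) : Prop where
  continuous : Continuous f
  differentiableOn : ∀ e, DifferentiableOn ℝ (comp f e) (Icc 0 (G.len e))
  absolutelyContinuous : ∀ e, AbsolutelyContinuousOnInterval (edgeDeriv f e) 0 (G.len e)
  memLp : MemLp f 2 G.vol
  memLp_D2 : MemLp (D2 f) 2 G.vol
  kirchhoff : ∀ v ∉ G.bdry, Kirchhoff f v

theorem edgeDeriv_add {f g : G.Point → ℝ} {e : E}
    (hf : DifferentiableOn ℝ (comp f e) (Icc 0 (G.len e)))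
    (hg : DifferentiableOn ℝ (comp g e) (Icc 0 (G.len e))) :
    edgeDeriv (f + g) e = edgeDeriv f e + edgeDeriv g e := by
  funext t
  by_cases ht : t ∈ Icc 0 (G.len e)
  · exact derivWithin_add (hf t ht) (hg t ht)
  · have ht' : t ∉ closure (Icc 0 (G.len e)) := by rwa [isClosed_Icc.closure_eq]
    simp [edgeDeriv, derivWithin_zero_of_notMem_closure ht']

theorem edgeDeriv_smul (c : ℝ) (f : G.Point → ℝ) (e : E) :
    edgeDeriv (c • f) e = fun t => c * edgeDeriv f e t := by
  funext t
  exact derivWithin_const_mul_field c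

theorem D2_smul (c : ℝ) (f : G.Point → ℝ) : D2 (c • f) = c • D2 f := by
  funext x
  cases x with
  | vertex v => simp [D2]
  | inner e t ht =>
    simp only [D2, edgeDeriv_smul, Pi.smul_apply, smul_eq_mul]
    exact deriv_const_mul_field c

theorem ae_vol_of_edges {p : G.Point → Prop} [Countable E]
    (h : ∀ e, ∀ᵐ t : ℝ, ∀ ht : t ∈ Ioo 0 (G.len e), p (.inner e t ht)) : ∀ᵐ x ∂G.vol, p x := by
  rw [vol, Measure.ae_sum_iff]
  intro e
  obtain ⟨s, hs, hsm, hs0⟩ := exists_measurable_superset_of_null (ae_iff.1 (h e))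
  have hm : MeasurableSet {x : G.Point | ∃ t ht, x = .inner e t ht ∧ t ∉ s} := by
    intro e'
    by_cases he : e' = e
    · subst he
      convert (measurableSet_Ioo (a := (0 : ℝ)) (b := G.len e')).diff hsm using 1
      ext t
      simp only [mem_preimage, mem_ofPred_eq, mem_sdiff]
      constructor
      · rintro ⟨u, hu, hx, hus⟩
        by_cases ht : t ∈ Ioo 0 (G.len e')
        · rw [pt_of_mem G ht] at hx
          cases hx
          exact ⟨hu, hus⟩
        · simp only [pt, ht, dite_false] at hx
          split_ifs at hx
      · rintro ⟨ht, hts⟩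
        exact ⟨t, ht, pt_of_mem G ht, hts⟩
    · convert MeasurableSet.empty using 1
      ext t
      simp only [mem_preimage, mem_ofPred_eq, mem_empty_iff_false, iff_false]
      rintro ⟨u, hu, hx, -⟩
      simp only [pt] at hx
      split_ifs at hx
      cases hx
      exact he rfl
  have key : ∀ᵐ x ∂(volume.restrict (Ioo 0 (G.len e))).map (G.pt e),
      ∃ t ht, x = .inner e t ht ∧ t ∉ s := by
    rw [ae_map_iff (measurable_pt e).aemeasurable hm, ae_restrict_iff' measurableSet_Ioo]
    have : ∀ᵐ t : ℝ, t ∉ s := by rw [ae_iff]; simpa using hs0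
    filter_upwards [this] with t hts ht
    exact ⟨t, ht, pt_of_mem G ht, hts⟩
  filter_upwards [key] with x hx
  obtain ⟨t, ht, rfl, hts⟩ := hx
  by_contra hp
  exact hts (hs fun h' => hp (h' ht))

theorem ae_edge_of_ae_vol {p : G.Point → Prop} (h : ∀ᵐ x ∂G.vol, p x) (e : E) :
    ∀ᵐ t ∂volume.restrict (Ioo 0 (G.len e)), p (G.pt e t) :=
  ae_of_ae_map (measurable_pt e).aemeasurable
    ((Measure.absolutelyContinuous_sum_right e Measure.AbsolutelyContinuous.rfl).ae_le h)

theorem D2_add_ae [Countable E] {f g : G.Point → ℝ} (hf : IsDmax f) (hg : IsDmax g) :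
    D2 (f + g) =ᵐ[G.vol] D2 f + D2 g := by
  refine ae_vol_of_edges fun e => ?_
  filter_upwards [(hf.absolutelyContinuous e).ae_differentiableAt,
    (hg.absolutelyContinuous e).ae_differentiableAt] with t h₁ h₂ ht
  have ht' : t ∈ uIcc 0 (G.len e) := by
    rw [uIcc_of_le (G.len_pos e).le]; exact Ioo_subset_Icc_self ht
  simp only [D2, Pi.add_apply, edgeDeriv_add (hf.differentiableOn e) (hg.differentiableOn e)]
  exact deriv_add (h₁ ht') (h₂ ht')

theorem outDeriv_add {f g : G.Point → ℝ} (hf : IsDmax f) (hg : IsDmax g) (d : E × Bool) :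
    outDeriv (f + g) d = outDeriv f d + outDeriv g d := by
  rcases d with ⟨e, _ | _⟩ <;>
    simp [outDeriv, edgeDeriv_add (hf.differentiableOn e) (hg.differentiableOn e), add_comm]

theorem outDeriv_smul (c : ℝ) (f : G.Point → ℝ) (d : E × Bool) :
    outDeriv (c • f) d = c * outDeriv f d := by
  rcases d with ⟨e, _ | _⟩ <;> simp [outDeriv, edgeDeriv_smul]

theorem IsDmax.add [Countable E] {f g : G.Point → ℝ} (hf : IsDmax f) (hg : IsDmax g) :
    IsDmax (f + g) where
  continuous := hf.continuous.add hg.continuous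
  differentiableOn e := (hf.differentiableOn e).add (hg.differentiableOn e)
  absolutelyContinuous e := by
    rw [edgeDeriv_add (hf.differentiableOn e) (hg.differentiableOn e)]
    exact (hf.absolutelyContinuous e).add (hg.absolutelyContinuous e)
  memLp := hf.memLp.add hg.memLp
  memLp_D2 := (hf.memLp_D2.add hg.memLp_D2).ae_eq (D2_add_ae hf hg).symm
  kirchhoff v hv := by
    simp only [Kirchhoff, outDeriv_add hf hg, Finset.sum_add_distrib]
    rw [hf.kirchhoff v hv, hg.kirchhoff v hv, add_zero]

theorem IsDmax.smul {f : G.Point → ℝ} (c : ℝ) (hf : IsDmax f) : IsDmax (c • f) where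
  continuous := hf.continuous.const_smul c
  differentiableOn e := (hf.differentiableOn e).const_smul c
  absolutelyContinuous e := by
    rw [edgeDeriv_smul]
    exact (hf.absolutelyContinuous e).const_mul c
  memLp := hf.memLp.const_smul c
  memLp_D2 := by
    rw [D2_smul]
    exact hf.memLp_D2.const_smul c
  kirchhoff v hv := by
    simp only [Kirchhoff, outDeriv_smul, ← Finset.mul_sum]
    rw [hf.kirchhoff v hv, mul_zero]

theorem edgeDeriv_zero (e : E) : edgeDeriv (0 : G.Point → ℝ) e = 0 := by
  funext t
  exact derivWithin_fun_const (Icc 0 (G.len e)) (0 : ℝ) ▸ rfl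

theorem D2_zero : D2 (0 : G.Point → ℝ) = 0 := by
  funext x
  cases x with
  | vertex v => rfl
  | inner e t ht =>
    simp only [D2, edgeDeriv_zero]
    exact deriv_const ..

theorem isDmax_zero : IsDmax (0 : G.Point → ℝ) where
  continuous := continuous_const
  differentiableOn _ := differentiableOn_const _
  absolutelyContinuous e := by
    rw [edgeDeriv_zero]
    exact (ContDiffOn.absolutelyContinuousOnInterval contDiffOn_const)
  memLp := MemLp.zero
  memLp_D2 := by rw [D2_zero]; exact MemLp.zero
  kirchhoff v _ := Finset.sum_eq_zero fun d _ => by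
    rcases d with ⟨e, _ | _⟩ <;> simp [outDeriv, edgeDeriv_zero]

theorem D2_eq_zero_of_ae [Countable E] {f : G.Point → ℝ} (hf : IsDmax f) (h : f =ᵐ[G.vol] 0) :
    D2 f =ᵐ[G.vol] 0 := by
  refine ae_vol_of_edges fun e => .of_forall fun t ht => ?_
  have h0 : EqOn (comp f e) 0 (Ioo 0 (G.len e)) :=
    Measure.eqOn_open_of_ae_eq (ae_edge_of_ae_vol h e) isOpen_Ioo
      ((hf.differentiableOn e).continuousOn.mono Ioo_subset_Icc_self) continuousOn_const
  have h1 : EqOn (edgeDeriv f e) 0 (Ioo 0 (G.len e)) := fun s hs => by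
    rw [edgeDeriv, derivWithin_of_mem_nhds (Icc_mem_nhds hs.1 hs.2),
      (h0.eventuallyEq_of_mem (isOpen_Ioo.mem_nhds hs)).deriv_eq]
    exact deriv_const ..
  simp only [D2, (h1.eventuallyEq_of_mem (isOpen_Ioo.mem_nhds ht)).deriv_eq]
  exact deriv_const ..

/-- The graph of `-D²` on a space `D` of functions in `𝒟_max`: the pairs `(f, -D² f)`, `f ∈ D`,
taken in `L²(G) × L²(G)`. -/
def negD2Graph [Countable E] (D : Submodule ℝ (G.Point → ℝ)) (hD : ∀ f ∈ D, IsDmax f) :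
    Submodule ℝ (G.L2 × G.L2) where
  carrier := {p | ∃ f ∈ D, p.1 =ᵐ[G.vol] f ∧ p.2 =ᵐ[G.vol] -D2 f}
  zero_mem' := ⟨0, D.zero_mem, Lp.coeFn_zero .., by
    rw [D2_zero, neg_zero]; exact Lp.coeFn_zero ..⟩
  add_mem' := by
    rintro p q ⟨f, hf, h₁, h₂⟩ ⟨g, hg, h₃, h₄⟩
    refine ⟨f + g, D.add_mem hf hg, (Lp.coeFn_add _ _).trans (h₁.add h₃),
      (Lp.coeFn_add _ _).trans ((h₂.add h₄).trans ?_)⟩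
    filter_upwards [D2_add_ae (hD f hf) (hD g hg)] with x hx
    simp only [Pi.add_apply, Pi.neg_apply] at hx ⊢
    rw [hx]; ring
  smul_mem' := by
    rintro c p ⟨f, hf, h₁, h₂⟩
    refine ⟨c • f, D.smul_mem c hf, (Lp.coeFn_smul _ _).trans (h₁.const_smul c),
      (Lp.coeFn_smul _ _).trans ((h₂.const_smul c).trans ?_)⟩
    rw [D2_smul, smul_neg]

/-- The operator `-D²` on `L²(G)` with domain `D`. -/
def negD2 [Countable E] (D : Submodule ℝ (G.Point → ℝ)) (hD : ∀ f ∈ D, IsDmax f) :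
    G.L2 →ₗ.[ℝ] G.L2 :=
  (negD2Graph D hD).toLinearPMap

/-- The pairs `(f, -D² f)`, `f ∈ D`, do form the graph of `negD2 D`. -/
theorem graph_negD2 [Countable E] (D : Submodule ℝ (G.Point → ℝ)) (hD : ∀ f ∈ D, IsDmax f) :
    (negD2 D hD).graph = negD2Graph D hD := by
  refine Submodule.toLinearPMap_graph_eq _ ?_
  rintro ⟨u, w⟩ ⟨f, hf, h₁, h₂⟩ hu
  simp only at h₁ h₂ hu
  subst hu
  have h0 := D2_eq_zero_of_ae (hD f hf) (h₁.symm.trans (Lp.coeFn_zero ..))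
  refine Lp.ext (h₂.trans (Filter.EventuallyEq.trans ?_ (Lp.coeFn_zero ..).symm))
  filter_upwards [h0] with x hx
  simp [hx]

/-- A function is harmonic on an open subset `U` of the completion if it is continuous on `U`,
satisfies `D² h = 0` on the parts of the edges in `U`, and satisfies the vertex condition at the
interior vertices in `U`. -/
structure HarmonicOn (h : G.Cpl → ℝ) (U : Set G.Cpl) : Prop where
  continuousOn : ContinuousOn h U
  D2_eq_zero : ∀ e, ∀ t ∈ Ioo 0 (G.len e), (G.pt e t : G.Cpl) ∈ U →
    DifferentiableAt ℝ (comp (fun x : G.Point => h x) e) t ∧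
      HasDerivAt (deriv (comp (fun x : G.Point => h x) e)) 0 t
  kirchhoff : ∀ v ∉ G.bdry, ((Point.vertex v : G.Point) : G.Cpl) ∈ U →
    Kirchhoff (fun x : G.Point => h x) v

variable (G) in
/-- The initial data: a finite partition `E 0, …, E N` of the boundary into clopen sets with
pairwise disjoint `δ`-neighborhoods, those of `E 1, …, E N` having finite volume, and functions
`h` such that `h n` is harmonic and square integrable on the `δ`-neighborhood of `E (n + 1)`. The
set `E 0`, whose neighborhoods may have infinite volume, is allowed to be empty, that is, it may be
absent; the other sets are nonempty. -/
structure BoundaryData where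
  N : ℕ
  E : Fin (N + 1) → Set G.boundary
  δ : ℝ
  h : Fin N → G.Cpl → ℝ
  isClopen : ∀ n, IsClopen (E n)
  nonempty : ∀ n : Fin N, (E n.succ).Nonempty
  disjoint : Pairwise fun m n => Disjoint (E m) (E n)
  iUnion_eq : ⋃ n, E n = univ
  δ_pos : 0 < δ
  disjoint_nbhd : Pairwise fun m n => Disjoint (nbhd δ (E m)) (nbhd δ (E n))
  vol_lt_top : ∀ n : Fin N, G.vol {x | (x : G.Cpl) ∈ nbhd δ (E n.succ)} < ⊤
  harmonic : ∀ n : Fin N, HarmonicOn (h n) (nbhd δ (E n.succ))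
  memLp : ∀ n : Fin N, MemLp (fun x : G.Point => h n x) 2
    (G.vol.restrict {x | (x : G.Cpl) ∈ nbhd δ (E n.succ)})

/-- A partition of the boundary, as the set of its members `A`, each paired with a label
`n ∈ {0, …, N}`: the label `0` means that functions have to vanish near `A`, the label `n + 1` that
the function `h n` is assigned to `A`. -/
abbrev BoundaryData.LabelledPartition (B : BoundaryData G) : Type _ :=
  Set (Set G.boundary × Fin (B.N + 1))

/-- The initial partition `ℰ(0)` with the assignment `ℋ(0)`. -/
def BoundaryData.initial (B : BoundaryData G) : B.LabelledPartition :=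
  {p | p.1.Nonempty ∧ p.1 = B.E p.2}

/-- `A₁` and `A₂` are disjoint nonempty clopen sets with union `A`. -/
def IsClopenSplit {X : Type*} [TopologicalSpace X] (A A₁ A₂ : Set X) : Prop :=
  IsClopen A₁ ∧ IsClopen A₂ ∧ A₁.Nonempty ∧ A₂.Nonempty ∧ Disjoint A₁ A₂ ∧ A₁ ∪ A₂ = A

/-- `Q` arises from `P` by splitting each member of `P` into two disjoint nonempty clopen sets, or
keeping it if it cannot be split; the label of a set passes to its parts. -/
def BoundaryData.IsStep (B : BoundaryData G) (P Q : B.LabelledPartition) : Prop :=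
  ∃ parts : Set G.boundary × Fin (B.N + 1) → Set (Set G.boundary),
    (∀ p ∈ P, (∃ A₁ A₂, IsClopenSplit p.1 A₁ A₂ ∧ parts p = {A₁, A₂}) ∨
      ((¬ ∃ A₁ A₂, IsClopenSplit p.1 A₁ A₂) ∧ parts p = {p.1})) ∧
    Q = {q | ∃ p ∈ P, q.1 ∈ parts p ∧ q.2 = p.2}

/-- A sequence of partitions `ℰ(j)` with assignments `ℋ(j)`, obtained inductively from the initial
one. -/
structure BoundaryData.Refinement (B : BoundaryData G) where
  P : ℕ → B.LabelledPartition
  zero : P 0 = B.initial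
  step : ∀ j, B.IsStep (P j) (P (j + 1))

/-- `φ` vanishes on the `ε`-neighborhood of the sets in `P` with label `0` and is a constant
multiple of the assigned function on the `ε`-neighborhood of each of the other sets in `P`. -/
def BoundaryData.Near (B : BoundaryData G) (P : B.LabelledPartition) (ε : ℝ)
    (φ : G.Point → ℝ) : Prop :=
  (∀ A, (A, 0) ∈ P → ∀ x : G.Point, (x : G.Cpl) ∈ nbhd ε A → φ x = 0) ∧
  ∀ A (n : Fin B.N), (A, n.succ) ∈ P →
    ∃ c : ℝ, ∀ x : G.Point, (x : G.Cpl) ∈ nbhd ε A → φ x = c * B.h n x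

theorem nbhd_mono {ε ε' : ℝ} (h : ε ≤ ε') {A A' : Set G.boundary} (hA : A ⊆ A') :
    nbhd ε A ⊆ nbhd ε' A' :=
  (Metric.thickening_mono h _).trans (Metric.thickening_subset_of_subset _ (image_mono hA))

theorem BoundaryData.Near.mono {B : BoundaryData G} {P : B.LabelledPartition} {ε ε' : ℝ}
    (h : ε' ≤ ε) {φ : G.Point → ℝ} (hφ : B.Near P ε φ) : B.Near P ε' φ :=
  ⟨fun A hA x hx => hφ.1 A hA x (nbhd_mono h subset_rfl hx), fun A n hA =>
    (hφ.2 A n hA).imp fun _ hc x hx => hc x (nbhd_mono h subset_rfl hx)⟩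

/-- The domain `𝒟_{ℰ,ℋ}`. -/
def BoundaryData.domain [Countable E] (B : BoundaryData G) (P : B.LabelledPartition) :
    Submodule ℝ (G.Point → ℝ) where
  carrier := {φ | IsDmax φ ∧ ∃ ε, 0 < ε ∧ ε < B.δ ∧ B.Near P ε φ}
  zero_mem' := ⟨isDmax_zero, B.δ / 2, half_pos B.δ_pos, half_lt_self B.δ_pos,
    fun _ _ _ _ => rfl, fun _ _ _ => ⟨0, by simp⟩⟩
  add_mem' := by
    rintro f g ⟨hf, ε, hε, hεδ, hfn⟩ ⟨hg, ε', hε', hεδ', hgn⟩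
    replace hfn := hfn.mono (min_le_left ε ε')
    replace hgn := hgn.mono (min_le_right ε ε')
    refine ⟨hf.add hg, min ε ε', lt_min hε hε', min_lt_of_left_lt hεδ, fun A hA x hx => ?_,
      fun A n hA => ?_⟩
    · simp [hfn.1 A hA x hx, hgn.1 A hA x hx]
    · obtain ⟨c, hc⟩ := hfn.2 A n hA
      obtain ⟨c', hc'⟩ := hgn.2 A n hA
      exact ⟨c + c', fun x hx => by simp [hc x hx, hc' x hx, add_mul]⟩
  smul_mem' := by
    rintro a f ⟨hf, ε, hε, hεδ, hfn⟩
    refine ⟨hf.smul a, ε, hε, hεδ, fun A hA x hx => by simp [hfn.1 A hA x hx], fun A n hA => ?_⟩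
    obtain ⟨c, hc⟩ := hfn.2 A n hA
    exact ⟨a * c, fun x hx => by simp [hc x hx, mul_assoc]⟩

theorem BoundaryData.domain_le_of_isStep [Countable E] {B : BoundaryData G}
    {P Q : B.LabelledPartition} (h : B.IsStep P Q) : B.domain P ≤ B.domain Q := by
  obtain ⟨parts, hparts, rfl⟩ := h
  have hsub : ∀ p ∈ P, ∀ A ∈ parts p, A ⊆ p.1 := by
    intro p hp A hA
    rcases hparts p hp with ⟨A₁, A₂, hs, he⟩ | ⟨-, he⟩
    · rw [he] at hA
      rw [← hs.2.2.2.2.2]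
      rcases hA with rfl | rfl
      · exact subset_union_left
      · exact subset_union_right
    · rw [he] at hA
      exact hA.le
  rintro f ⟨hf, ε, hε, hεδ, hn⟩
  refine ⟨hf, ε, hε, hεδ, ?_, ?_⟩
  · rintro A ⟨⟨A', l⟩, hp, hA, rfl⟩ x hx
    exact hn.1 A' hp x (nbhd_mono le_rfl (hsub _ hp A hA) hx)
  · rintro A n ⟨⟨A', l⟩, hp, hA, rfl⟩
    exact (hn.2 A' n hp).imp fun c hc x hx => hc x (nbhd_mono le_rfl (hsub _ hp A hA) hx)

/-- The operator `S_{ℰ(j),ℋ(j)}`. -/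
def BoundaryData.Refinement.S [Countable E] {B : BoundaryData G} (R : B.Refinement) (j : ℕ) :
    G.L2 →ₗ.[ℝ] G.L2 :=
  negD2 (B.domain (R.P j)) fun _ hf => hf.1

/-- The union of the increasing domains `𝒟_{ℰ(j),ℋ(j)}`. -/
def BoundaryData.Refinement.domainU [Countable E] {B : BoundaryData G} (R : B.Refinement) :
    Submodule ℝ (G.Point → ℝ) where
  carrier := {f | ∃ j, f ∈ B.domain (R.P j)}
  zero_mem' := ⟨0, zero_mem _⟩
  add_mem' := by
    rintro f g ⟨i, hi⟩ ⟨j, hj⟩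
    have hm : Monotone fun j => B.domain (R.P j) :=
      monotone_nat_of_le_succ fun j => BoundaryData.domain_le_of_isStep (R.step j)
    exact ⟨max i j, add_mem (hm (le_max_left i j) hi) (hm (le_max_right i j) hj)⟩
  smul_mem' := by
    rintro c f ⟨j, hj⟩
    exact ⟨j, Submodule.smul_mem _ c hj⟩

/-- The operator `S_U`. -/
def BoundaryData.Refinement.SU [Countable E] {B : BoundaryData G} (R : B.Refinement) :
    G.L2 →ₗ.[ℝ] G.L2 :=
  negD2 R.domainU fun _ hf => hf.choose_spec.1

end MetricGraph

/-- A symmetric operator on a Hilbert space: densely defined, with `⟪T x, y⟫ = ⟪x, T y⟫` for all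
`x`, `y` in the domain. -/
def IsSymmetricOperator {H : Type*} [NormedAddCommGroup H] [InnerProductSpace ℝ H]
    (T : H →ₗ.[ℝ] H) : Prop :=
  Dense (T.domain : Set H) ∧ T.IsFormalAdjoint T

/-- `T` has an extension that is equal to its adjoint. -/
def HasSelfAdjointExtension {H : Type*} [NormedAddCommGroup H] [InnerProductSpace ℝ H]
    [CompleteSpace H] (T : H →ₗ.[ℝ] H) : Prop :=
  ∃ A : H →ₗ.[ℝ] H, T ≤ A ∧ IsSelfAdjoint A

end

/-! Symmetry is Green's identity. For `f`, `g` in one domain, integrating `f'' g - f g''` edge by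
edge leaves minus the sum of the Wronskians of `f` and `g` over all ends of edges
(`integral_edge_D2`). Near each boundary point both functions are multiples of one function, so
their Wronskian vanishes there. Since the completion is compact and the graph locally finite, only
finitely many vertices are not near the boundary (`finite_vertex_notMem_thickening`). The sum over
ends is therefore finite and can be regrouped by vertices. The remaining vertices are interior, and
there continuity and the vertex condition make each group vanish (`integral_D2_mul_comm`).

The domains are dense because they contain all smooth functions compactly supported in a single open
edge. The domains increase with `j`, so two functions in the union lie in a common one, and symmetry
passes to `S_U`.

Over the reals, symmetry alone yields a self-adjoint extension: a symmetric subspace of `H × H` can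
be enlarged by any element of its adjoint, so a maximal one equals its adjoint. -/

/-! ### Self-adjoint extensions on a real Hilbert space -/

/-- A densely defined symmetric operator on a real Hilbert space has a self-adjoint extension. -/
theorem IsSymmetricOperator.hasSelfAdjointExtension {H : Type*} [NormedAddCommGroup H]
    [InnerProductSpace ℝ H] [CompleteSpace H] {T : H →ₗ.[ℝ] H} (hT : IsSymmetricOperator T) :
    HasSelfAdjointExtension T := by
  obtain ⟨hd, hs⟩ := hT
  -- Zorn's lemma is applied to symmetric linear relations rather than operators; single-valuedness
  -- is recovered at the end.
  let S : Set (Submodule ℝ (H × H)) :=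
    {L | ∀ p ∈ L, ∀ q ∈ L, inner ℝ p.2 q.1 = inner ℝ p.1 q.2}
  have hTS : T.graph ∈ S := by
    intro p hp q hq
    rw [LinearPMap.mem_graph_iff] at hp hq
    obtain ⟨x, hx, hx'⟩ := hp
    obtain ⟨y, hy, hy'⟩ := hq
    rw [← hx, ← hx', ← hy, ← hy']
    exact hs x y
  obtain ⟨L, hTL, hL⟩ := zorn_le_nonempty₀ S (fun c hcS hc y hy => by
    refine ⟨sSup c, fun p hp q hq => ?_, fun z hz => le_sSup hz⟩
    rw [Submodule.mem_sSup_of_directed ⟨y, hy⟩ hc.directedOn] at hp hq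
    obtain ⟨M, hM, hp⟩ := hp
    obtain ⟨M', hM', hq⟩ := hq
    rcases hc.total hM hM' with h | h
    · exact hcS hM' p (h hp) q hq
    · exact hcS hM p hp q (h hq)) T.graph hTS
  have hLS : ∀ p ∈ L, ∀ q ∈ L, inner ℝ p.2 q.1 = inner ℝ p.1 q.2 := hL.prop
  have hLadj : L.adjoint = L := by
    refine le_antisymm (fun x hx => ?_) (fun x hx => ?_)
    · rw [Submodule.mem_adjoint_iff] at hx
      -- The cross terms agree because `x` lies in the adjoint of `L`. The term of `x` with itself
      -- compares `⟪x.2, x.1⟫` with `⟪x.1, x.2⟫`, which are equal because the scalars are real.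
      have hS : L ⊔ Submodule.span ℝ {x} ∈ S := by
        intro p hp q hq
        rw [Submodule.mem_sup] at hp hq
        obtain ⟨p, hp, u, hu, rfl⟩ := hp
        obtain ⟨q, hq, w, hw, rfl⟩ := hq
        obtain ⟨a, rfl⟩ := Submodule.mem_span_singleton.1 hu
        obtain ⟨b, rfl⟩ := Submodule.mem_span_singleton.1 hw
        have h1 := sub_eq_zero.1 (hx p.1 p.2 hp)
        have h2 := sub_eq_zero.1 (hx q.1 q.2 hq)
        simp only [Prod.fst_add, Prod.snd_add, Prod.smul_fst, Prod.smul_snd, inner_add_left,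
          inner_add_right, real_inner_smul_left, real_inner_smul_right]
        rw [hLS p hp q hq, h1, real_inner_comm q.1 x.2, ← h2, real_inner_comm q.2 x.1,
          real_inner_comm x.1 x.2]
      exact hL.le_of_ge hS le_sup_left (Submodule.mem_sup_right (Submodule.mem_span_singleton_self x))
    · rw [Submodule.mem_adjoint_iff]
      intro a b hab
      rw [hLS (a, b) hab x hx, sub_self]
  -- If `(0, y) ∈ L`, symmetry against the graph of `T` makes `y` orthogonal to the dense domain of
  -- `T`.
  have hgraph : L.toLinearPMap.graph = L := by
    refine Submodule.toLinearPMap_graph_eq _ fun x hx hx0 => ?_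
    refine hd.eq_zero_of_inner_right ℝ fun a ha => ?_
    have := hLS (a, T ⟨a, ha⟩) (hTL (LinearPMap.mem_graph T ⟨a, ha⟩)) x hx
    simpa [hx0] using this.symm
  have hle : T ≤ L.toLinearPMap := LinearPMap.le_of_le_graph (by rwa [hgraph])
  refine ⟨L.toLinearPMap, hle, ?_⟩
  rw [LinearPMap.isSelfAdjoint_def]
  apply LinearPMap.eq_of_eq_graph
  rw [LinearPMap.adjoint_graph_eq_graph_adjoint (hd.mono hle.1), hgraph, hLadj]

namespace MetricGraph

variable {V E : Type*} {G : MetricGraph V E}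

/-! ### Lipschitz functions and the local geometry of the geodesic distance -/

/-- The increments along the segments of the path add up. This turns functions that are Lipschitz on
edges into lower bounds for the distance. -/
theorem HasPath.abs_sub_le {f : G.Point → ℝ} {K : ℝ}
    (hf : ∀ e, ∀ s ∈ Icc 0 (G.len e), ∀ t ∈ Icc 0 (G.len e),
      |comp f e s - comp f e t| ≤ K * |s - t|) {x y : G.Point} {L : ℝ} (h : G.HasPath x y L) :
    |f x - f y| ≤ K * L := by
  induction h with
  | nil x => simp
  | cons e s t hs ht y L h ih =>
    calc |f (G.pt e s) - f y| ≤ |f (G.pt e s) - f (G.pt e t)| + |f (G.pt e t) - f y| :=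
          _root_.abs_sub_le ..
      _ ≤ K * |s - t| + K * L := add_le_add (hf e s hs t ht) ih
      _ = _ := by ring

/-- A function that is Lipschitz along each edge is Lipschitz. -/
theorem abs_sub_le_mul_dist {f : G.Point → ℝ} {K : ℝ} (hK : 0 ≤ K)
    (hf : ∀ e, ∀ s ∈ Icc 0 (G.len e), ∀ t ∈ Icc 0 (G.len e),
      |comp f e s - comp f e t| ≤ K * |s - t|) (x y : G.Point) :
    |f x - f y| ≤ K * dist x y := by
  rcases hK.eq_or_lt with rfl | hK'
  · obtain ⟨L, hL⟩ := exists_hasPath x y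
    simpa using hL.abs_sub_le hf
  · rw [← div_le_iff₀' hK']
    refine le_csInf (exists_hasPath x y) fun L hL => ?_
    rw [div_le_iff₀' hK']
    exact HasPath.abs_sub_le hf hL

theorem dist_pt_le (e : E) {s t : ℝ} (hs : s ∈ Icc 0 (G.len e)) (ht : t ∈ Icc 0 (G.len e)) :
    dist (G.pt e s) (G.pt e t) ≤ |s - t| :=
  csInf_le ⟨0, fun _ h => h.nonneg⟩ (HasPath.single e hs ht)

theorem continuousOn_pt (e : E) : ContinuousOn (G.pt e) (Icc 0 (G.len e)) := by
  refine LipschitzOnWith.continuousOn (K := 1) (LipschitzOnWith.of_dist_le_mul fun s hs t ht => ?_)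
  simpa [Real.dist_eq] using dist_pt_le e hs ht

/-- The function that equals `g` on the open edge `e` and vanishes on the rest of the graph. -/
noncomputable def edgeExt (e : E) (g : ℝ → ℝ) : G.Point → ℝ
  | .vertex _ => 0
  | .inner e' t _ => open Classical in if e' = e then g t else 0

theorem edgeExt_pt_of_mem {e : E} {g : ℝ → ℝ} {t : ℝ} (ht : t ∈ Ioo 0 (G.len e)) :
    edgeExt e g (G.pt e t) = g t := by
  simp [pt_of_mem G ht, edgeExt]

theorem comp_edgeExt_of_ne {e e' : E} (h : e' ≠ e) (g : ℝ → ℝ) :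
    comp (edgeExt (G := G) e g) e' = 0 := by
  funext t
  simp only [comp, pt, Pi.zero_apply]
  split_ifs <;> simp [edgeExt, h]

theorem comp_edgeExt {e : E} {g : ℝ → ℝ} (hg : ∀ t ∉ Ioo 0 (G.len e), g t = 0) :
    comp (edgeExt (G := G) e g) e = g := by
  funext t
  by_cases ht : t ∈ Ioo 0 (G.len e)
  · exact edgeExt_pt_of_mem ht
  · simp only [comp, pt, ht, dite_false, hg t ht]
    split_ifs <;> rfl

theorem abs_edgeExt_sub_le {e : E} {g : ℝ → ℝ} {K : ℝ} (hK : 0 ≤ K)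
    (h0 : ∀ t ∉ Ioo 0 (G.len e), g t = 0)
    (hg : ∀ s ∈ Icc 0 (G.len e), ∀ t ∈ Icc 0 (G.len e), |g s - g t| ≤ K * |s - t|)
    (x y : G.Point) : |edgeExt e g x - edgeExt e g y| ≤ K * dist x y := by
  refine abs_sub_le_mul_dist hK (fun e' s hs t ht => ?_) x y
  by_cases he : e' = e
  · subst he
    rw [comp_edgeExt h0]
    exact hg s hs t ht
  · rw [comp_edgeExt_of_ne he]
    simp only [Pi.zero_apply, sub_self, abs_zero]
    positivity

/-- A ball about a point of an open edge that does not reach the ends of the edge is contained in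
that edge. -/
theorem exists_pt_of_dist_lt {e : E} {t : ℝ} (ht : t ∈ Ioo 0 (G.len e)) {c : ℝ} (hc : 0 ≤ c)
    {x : G.Point} (hx : dist x (G.pt e t) < min t (G.len e - t) - c) :
    ∃ s ∈ Ioo 0 (G.len e), s ∈ Icc c (G.len e - c) ∧ x = G.pt e s := by
  -- The distance to the nearer end of `e`, extended by zero, is 1-Lipschitz on the whole graph. Its
  -- value at `x` exceeds `c ≥ 0`, which forces `x` into the open edge `e` and away from its ends.
  let g : ℝ → ℝ := fun s => max 0 (min s (G.len e - s))
  have h0 : ∀ s ∉ Ioo 0 (G.len e), g s = 0 := by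
    intro s hs
    apply max_eq_left
    by_contra! h
    rw [lt_min_iff] at h
    exact hs ⟨h.1, by linarith⟩
  have hg : ∀ s u : ℝ, |g s - g u| ≤ 1 * |s - u| := by
    intro s u
    simp only [g]
    grind
  have hl := abs_edgeExt_sub_le zero_le_one h0 (fun s _ u _ => hg s u) (G.pt e t) x
  rw [edgeExt_pt_of_mem ht, one_mul, dist_comm] at hl
  have hgt : g t = min t (G.len e - t) := max_eq_right (le_min ht.1.le (by linarith [ht.2]))
  have hpos : c < edgeExt e g x := by
    have := le_abs_self (g t - edgeExt e g x)
    linarith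
  cases x with
  | vertex v => simp only [edgeExt] at hpos; linarith
  | inner e' s hs =>
    simp only [edgeExt] at hpos
    split_ifs at hpos with he
    · subst he
      refine ⟨s, hs, ?_, (pt_of_mem G hs).symm⟩
      simp only [g, lt_max_iff, lt_min_iff] at hpos
      rcases hpos with h | h
      · linarith
      · exact ⟨h.1.le, by linarith⟩
    · linarith

theorem finite_vertex_dist_lt_of_inner {e : E} {t : ℝ} (ht : t ∈ Ioo 0 (G.len e)) :
    ∃ r > 0, {v : V | dist (Point.vertex v) (G.pt e t) < r}.Finite := by
  refine ⟨min t (G.len e - t) - 0, ?_, Set.Finite.subset finite_empty fun v hv => ?_⟩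
  · simpa using ht
  · obtain ⟨s, hs, -, h⟩ := exists_pt_of_dist_lt ht le_rfl hv
    rw [pt_of_mem G hs] at h
    cases h

/-- By local finiteness the edges at `v` have lengths bounded below by some `r > 0`. A 1-Lipschitz
function equal to `0` at `v` and to `r` at all other vertices then separates `v` from them. -/
theorem exists_eq_of_dist_vertex_lt (v : V) :
    ∃ r > 0, ∀ w : V, dist (Point.vertex w : G.Point) (.vertex v) < r → w = v := by
  classical
  obtain ⟨r, hr, hlen⟩ : ∃ r > 0, ∀ e, G.src e = v ∨ G.tgt e = v → r ≤ G.len e := by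
    have hfin := (G.finite_ends v).image (fun d => G.len d.1)
    obtain ⟨r, hr, h⟩ : ∃ r > 0, ∀ l ∈ (fun d : E × Bool => G.len d.1) ''
        {d : E × Bool | cond d.2 (G.tgt d.1) (G.src d.1) = v}, r ≤ l := by
      induction hfin.toFinset.eq_empty_or_nonempty with
      | inl h => exact ⟨1, one_pos, fun l hl => absurd (hfin.mem_toFinset.2 hl) (by simp [h])⟩
      | inr h =>
        refine ⟨hfin.toFinset.min' h, ?_, fun l hl => Finset.min'_le _ _ (by simpa using hl)⟩
        have := hfin.toFinset.min'_mem h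
        rw [Set.Finite.mem_toFinset] at this
        obtain ⟨d, -, hd⟩ := this
        rw [← hd]
        exact G.len_pos _
    refine ⟨r, hr, fun e he => ?_⟩
    rcases he with he | he
    · exact h _ ⟨(e, false), he, rfl⟩
    · exact h _ ⟨(e, true), he, rfl⟩
  -- On an edge, `g` is the least 1-Lipschitz-compatible value coming from either end, capped at
  -- `r`. It matches `F₀` at the ends because edges at `v` have length at least `r`.
  let F₀ : V → ℝ := fun w => if w = v then 0 else r
  let g : E → ℝ → ℝ := fun e t => min r (min (F₀ (G.src e) + t) (F₀ (G.tgt e) + (G.len e - t)))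
  let F : G.Point → ℝ := fun x => match x with
    | .vertex w => F₀ w
    | .inner e t _ => g e t
  have hcomp : ∀ e, ∀ t ∈ Icc 0 (G.len e), comp F e t = g e t := by
    intro e t ht
    have hl := G.len_pos e
    by_cases hio : t ∈ Ioo 0 (G.len e)
    · simp [comp, pt_of_mem G hio, F]
    · obtain rfl | rfl : t = 0 ∨ t = G.len e := by
        by_contra! h
        exact hio ⟨lt_of_le_of_ne ht.1 h.1.symm, lt_of_le_of_ne ht.2 h.2⟩
      · simp only [comp, pt_zero, F, g, F₀]
        have := hlen e
        grind
      · simp only [comp, pt_len, F, g, F₀]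
        have := hlen e
        grind
  have hF := abs_sub_le_mul_dist (f := F) zero_le_one fun e s hs t ht => by
    rw [hcomp e s hs, hcomp e t ht]
    simp only [g]
    grind
  refine ⟨r, hr, fun w hw => ?_⟩
  have := hF (.vertex w) (.vertex v)
  by_contra hne
  simp only [F, F₀, hne, if_true, if_false, sub_zero, one_mul] at this
  exact absurd hw (not_lt.2 ((le_abs_self r).trans this))

theorem exists_finite_vertex_dist_lt (x : G.Point) :
    ∃ r > 0, {w : V | dist (Point.vertex w) x < r}.Finite := by
  cases x with
  | vertex v =>
    obtain ⟨r, hr, h⟩ := exists_eq_of_dist_vertex_lt (G := G) v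
    exact ⟨r, hr, (finite_singleton v).subset h⟩
  | inner e t ht => rw [← pt_of_mem G ht]; exact finite_vertex_dist_lt_of_inner ht

/-- Only finitely many vertices stay away from the boundary of a compact completion. -/
theorem finite_vertex_notMem_thickening [CompactSpace G.Cpl] {ε : ℝ} (hε : 0 < ε) :
    {v : V | ((Point.vertex v : G.Point) : G.Cpl) ∉ Metric.thickening ε G.boundary}.Finite := by
  have hK : IsCompact (Metric.thickening ε G.boundary)ᶜ :=
    Metric.isOpen_thickening.isClosed_compl.isCompact
  -- A point off the boundary comes from the graph itself, where vertices are locally finite in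
  -- number.
  have hloc : ∀ x ∈ (Metric.thickening ε G.boundary)ᶜ, ∃ U ∈ nhds x,
      {v : V | ((Point.vertex v : G.Point) : G.Cpl) ∈ U}.Finite := by
    intro x hx
    have hxb : x ∉ G.boundary := fun h => hx (Metric.self_subset_thickening hε _ h)
    simp only [boundary, mem_compl_iff, not_not] at hxb
    obtain ⟨p, -, rfl⟩ := hxb
    obtain ⟨r, hr, hfin⟩ := exists_finite_vertex_dist_lt p
    refine ⟨_, Metric.ball_mem_nhds _ hr, hfin.subset fun v hv => ?_⟩
    simpa [UniformSpace.Completion.dist_eq] using hv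
  choose! U hU hfin using hloc
  obtain ⟨t, ht, hcov⟩ := hK.elim_nhds_subcover U hU
  refine (t.finite_toSet.biUnion fun x hx => hfin x (ht x hx)).subset fun v hv => ?_
  have := hcov hv
  simpa using this

/-- The completion identifies points at distance zero, so it must be checked that a boundary vertex
is at positive distance from every other point of the graph. -/
theorem coe_vertex_mem_boundary {v : V} (hv : v ∈ G.bdry) :
    ((Point.vertex v : G.Point) : G.Cpl) ∈ G.boundary := by
  rintro ⟨x, hx, h⟩
  have hd : dist (Point.vertex v : G.Point) x = 0 := by
    rw [← UniformSpace.Completion.dist_eq, dist_eq_zero]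
    exact h.symm
  cases x with
  | vertex w =>
    obtain ⟨r, hr, h⟩ := exists_eq_of_dist_vertex_lt (G := G) w
    exact hx v hv (congrArg _ (h v (hd.trans_lt hr)).symm)
  | inner e t ht =>
    rw [← pt_of_mem G ht] at hd
    obtain ⟨s, hs, -, h⟩ := exists_pt_of_dist_lt (x := .vertex v) ht le_rfl
      (by rw [hd, sub_zero]; exact lt_min ht.1 (sub_pos.2 ht.2))
    rw [pt_of_mem G hs] at h
    cases h

/-! ### Green's identity -/

theorem hasSum_integral_edge {F : G.Point → ℝ} (hF : Integrable F G.vol) :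
    HasSum (fun e => ∫ t in Ioo 0 (G.len e), comp F e t) (∫ x, F x ∂G.vol) := by
  have h : ∀ e, ∫ x, F x ∂((volume.restrict (Ioo 0 (G.len e))).map (G.pt e)) =
      ∫ t in Ioo 0 (G.len e), comp F e t := fun e =>
    integral_map (measurable_pt e).aemeasurable
      (hF.mono_measure (Measure.le_sum _ e)).aestronglyMeasurable
  simp only [← h]
  exact hasSum_integral_measure hF

/-- The derivative is absolutely continuous, hence bounded on the edge, so the function is Lipschitz
there. -/
theorem IsDmax.absolutelyContinuous_comp {f : G.Point → ℝ} (hf : IsDmax f) (e : E) :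
    AbsolutelyContinuousOnInterval (comp f e) 0 (G.len e) := by
  obtain ⟨C, hC⟩ := (hf.absolutelyContinuous e).exists_bound
  rw [uIcc_of_le (G.len_pos e).le] at hC
  refine LipschitzOnWith.absolutelyContinuousOnInterval (K := C.toNNReal) ?_
  rw [uIcc_of_le (G.len_pos e).le]
  refine (convex_Icc ..).lipschitzOnWith_of_nnnorm_derivWithin_le (hf.differentiableOn e)
    fun t ht => ?_
  rw [← NNReal.coe_le_coe, coe_nnnorm]
  exact (hC t ht).trans (Real.le_coe_toNNReal C)

/-- The vertex at an end of an edge. -/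
def endVertex (G : MetricGraph V E) (d : E × Bool) : V := cond d.2 (G.tgt d.1) (G.src d.1)

/-- The Wronskian of `f` and `g` at an end of an edge. -/
noncomputable def endWronskian (f g : G.Point → ℝ) (d : E × Bool) : ℝ :=
  outDeriv f d * g (.vertex (G.endVertex d)) - f (.vertex (G.endVertex d)) * outDeriv g d

/-- Green's identity on an edge. -/
theorem integral_edge_D2 {f g : G.Point → ℝ} (hf : IsDmax f) (hg : IsDmax g) (e : E) :
    ∫ t in Ioo 0 (G.len e), comp (D2 f * g - f * D2 g) e t =
      -∑ b : Bool, endWronskian f g (e, b) := by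
  have hW : AbsolutelyContinuousOnInterval
      (edgeDeriv f e * comp g e - comp f e * edgeDeriv g e) 0 (G.len e) :=
    ((hf.absolutelyContinuous e).mul (hg.absolutelyContinuous_comp e)).sub
      ((hf.absolutelyContinuous_comp e).mul (hg.absolutelyContinuous e))
  have h := hW.integral_deriv_eq_sub
  rw [intervalIntegral.integral_of_le (G.len_pos e).le, integral_Ioc_eq_integral_Ioo] at h
  have hae : ∫ t in Ioo 0 (G.len e), comp (D2 f * g - f * D2 g) e t =
      ∫ t in Ioo 0 (G.len e), deriv (edgeDeriv f e * comp g e - comp f e * edgeDeriv g e) t := by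
    refine setIntegral_congr_ae measurableSet_Ioo ?_
    filter_upwards [(hf.absolutelyContinuous e).ae_differentiableAt,
      (hg.absolutelyContinuous e).ae_differentiableAt] with t h₁ h₂ ht
    have ht' : t ∈ uIcc 0 (G.len e) := by
      rw [uIcc_of_le (G.len_pos e).le]; exact Ioo_subset_Icc_self ht
    have hder : ∀ {k : G.Point → ℝ}, IsDmax k → HasDerivAt (comp k e) (edgeDeriv k e t) t :=
      fun {k} hk => ((hk.differentiableOn e t (Ioo_subset_Icc_self ht)).hasDerivWithinAt).hasDerivAt
        (Icc_mem_nhds ht.1 ht.2)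
    have := (((h₁ ht').hasDerivAt.mul (hder hg)).sub ((hder hf).mul (h₂ ht').hasDerivAt)).deriv
    rw [this]
    simp only [comp, Pi.sub_apply, Pi.mul_apply, pt_of_mem G ht, D2]
    ring
  rw [hae, h]
  -- The outward convention flips the sign at `len e`, so the two end Wronskians sum to minus the
  -- increment along the edge.
  simp only [Fintype.sum_bool, endWronskian, endVertex, outDeriv, cond_true, cond_false,
    Pi.sub_apply, Pi.mul_apply, comp, pt_zero, pt_len]
  ring

/-- The derivative within the edge depends only on the germ there, also at the ends of the edge. No
differentiability of `h` is needed, since scaling commutes with `derivWithin` over a field. -/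
theorem edgeDeriv_eq_of_eq_mul {f h : G.Point → ℝ} {U : Set G.Cpl} (hU : IsOpen U) {c : ℝ}
    (hf : ∀ x : G.Point, (x : G.Cpl) ∈ U → f x = c * h x) {e : E} {t : ℝ}
    (ht : t ∈ Icc 0 (G.len e)) (htU : (G.pt e t : G.Cpl) ∈ U) :
    edgeDeriv f e t = c * edgeDeriv h e t := by
  have hc : ContinuousWithinAt (fun s => (G.pt e s : G.Cpl)) (Icc 0 (G.len e)) t :=
    (UniformSpace.Completion.continuous_coe G.Point).continuousAt.comp_continuousWithinAt
      (continuousOn_pt e t ht)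
  have hev : comp f e =ᶠ[nhdsWithin t (Icc 0 (G.len e))] fun s => c * comp h e s := by
    filter_upwards [hc.preimage_mem_nhdsWithin (hU.mem_nhds htU)] with s hs
    exact hf _ hs
  rw [edgeDeriv, hev.derivWithin_eq (hf _ htU)]
  exact derivWithin_const_mul_field c

/-- The Wronskian of two multiples of the same function vanishes. -/
theorem endWronskian_eq_zero {f g h : G.Point → ℝ} {U : Set G.Cpl} (hU : IsOpen U) {a b : ℝ}
    (hf : ∀ x : G.Point, (x : G.Cpl) ∈ U → f x = a * h x)
    (hg : ∀ x : G.Point, (x : G.Cpl) ∈ U → g x = b * h x) {d : E × Bool}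
    (hd : ((Point.vertex (G.endVertex d) : G.Point) : G.Cpl) ∈ U) : endWronskian f g d = 0 := by
  rcases d with ⟨e, _ | _⟩
  · simp only [endWronskian, endVertex, outDeriv, cond_false] at hd ⊢
    rw [hf _ hd, hg _ hd]
    rw [← pt_zero] at hd
    have h0 := left_mem_Icc.2 (G.len_pos e).le
    rw [edgeDeriv_eq_of_eq_mul hU hf h0 hd, edgeDeriv_eq_of_eq_mul hU hg h0 hd]
    ring
  · simp only [endWronskian, endVertex, outDeriv, cond_true] at hd ⊢
    rw [hf _ hd, hg _ hd]
    rw [← pt_len] at hd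
    have h0 := right_mem_Icc.2 (G.len_pos e).le
    rw [edgeDeriv_eq_of_eq_mul hU hf h0 hd, edgeDeriv_eq_of_eq_mul hU hg h0 hd]
    ring

/-- The values of `f` and `g` at `v` are common to all its ends, so they factor out and leave the
two vertex conditions. -/
theorem sum_endWronskian_eq_zero {f g : G.Point → ℝ} (hf : IsDmax f) (hg : IsDmax g) {v : V}
    (hv : v ∉ G.bdry) : ∑ d ∈ (G.finite_ends v).toFinset, endWronskian f g d = 0 := by
  have h : ∀ d ∈ (G.finite_ends v).toFinset, endWronskian f g d =
      outDeriv f d * g (.vertex v) - f (.vertex v) * outDeriv g d := by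
    intro d hd
    have : G.endVertex d = v := (G.finite_ends v).mem_toFinset.1 hd
    rw [endWronskian, this]
  have h₁ := hf.kirchhoff v hv
  have h₂ := hg.kirchhoff v hv
  rw [Kirchhoff] at h₁ h₂
  rw [Finset.sum_congr rfl h, Finset.sum_sub_distrib, ← Finset.sum_mul, ← Finset.mul_sum, h₁, h₂]
  simp

/-- Green's identity for functions that are multiples of a common function near each boundary
point. -/
theorem integral_D2_mul_comm [CompactSpace G.Cpl] {f g : G.Point → ℝ} (hf : IsDmax f)
    (hg : IsDmax g) {ε : ℝ} (hε : 0 < ε)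
    (hfg : ∀ y ∈ G.boundary, ∃ (h : G.Point → ℝ) (a b : ℝ), ∀ x : G.Point,
      (x : G.Cpl) ∈ Metric.ball y ε → f x = a * h x ∧ g x = b * h x) :
    ∫ x, D2 f x * g x ∂G.vol = ∫ x, f x * D2 g x ∂G.vol := by
  classical
  have hi₁ : Integrable (D2 f * g) G.vol := hf.memLp_D2.integrable_mul hg.memLp
  have hi₂ : Integrable (f * D2 g) G.vol := hf.memLp.integrable_mul hg.memLp_D2
  have hsum := hasSum_integral_edge (hi₁.sub hi₂)
  simp only [integral_edge_D2 hf hg] at hsum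
  have hfin := finite_vertex_notMem_thickening (G := G) hε
  have hzero : ∀ d, G.endVertex d ∉ hfin.toFinset → endWronskian f g d = 0 := by
    intro d hd
    simp only [Set.Finite.mem_toFinset, mem_ofPred_eq, not_not] at hd
    obtain ⟨y, hy, hdy⟩ := Metric.mem_thickening_iff.1 hd
    obtain ⟨h, a, b, hab⟩ := hfg y hy
    exact endWronskian_eq_zero Metric.isOpen_ball (fun x hx => (hab x hx).1)
      (fun x hx => (hab x hx).2) hdy
  -- The family over `E × Bool` has finite support, contained in the ends at vertices away from the
  -- boundary. It is summed here by vertices and below by edges, and the two totals must agree.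
  have hW : HasSum (endWronskian f g) 0 := by
    have h0 : ∑ d ∈ hfin.toFinset.biUnion fun v => (G.finite_ends v).toFinset,
        endWronskian f g d = 0 := by
      rw [Finset.sum_biUnion]
      · refine Finset.sum_eq_zero fun v hv => sum_endWronskian_eq_zero hf hg fun hb => ?_
        rw [Set.Finite.mem_toFinset] at hv
        exact hv (Metric.self_subset_thickening hε _ (coe_vertex_mem_boundary hb))
      · intro v _ w _ hvw
        refine Finset.disjoint_left.2 fun d hd hd' => hvw ?_
        rw [Set.Finite.mem_toFinset] at hd hd'
        exact hd.symm.trans hd'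
    rw [← h0]
    refine hasSum_sum_of_ne_finset_zero fun d hd => hzero d fun hv => hd ?_
    exact Finset.mem_biUnion.2 ⟨_, hv, (G.finite_ends _).mem_toFinset.2 rfl⟩
  have h := hsum.unique (hW.prod_fiberwise fun e => hasSum_fintype _).neg
  rw [neg_zero, integral_sub' hi₁ hi₂, sub_eq_zero] at h
  exact h

/-! ### Symmetry on the domains attached to the partitions -/

theorem BoundaryData.Refinement.exists_mem {B : BoundaryData G} (R : B.Refinement) (j : ℕ)
    (y : G.boundary) : ∃ p ∈ R.P j, y ∈ p.1 := by
  induction j with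
  | zero =>
    rw [R.zero]
    obtain ⟨n, hn⟩ := mem_iUnion.1 (B.iUnion_eq.symm ▸ mem_univ y)
    exact ⟨(B.E n, n), ⟨⟨y, hn⟩, rfl⟩, hn⟩
  | succ j ih =>
    obtain ⟨p, hp, hy⟩ := ih
    obtain ⟨parts, hparts, hQ⟩ := R.step j
    rw [hQ]
    rcases hparts p hp with ⟨A₁, A₂, hs, he⟩ | ⟨-, he⟩
    · rw [← hs.2.2.2.2.2] at hy
      rcases hy with hy | hy
      · exact ⟨(A₁, p.2), ⟨p, hp, by simp [he], rfl⟩, hy⟩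
      · exact ⟨(A₂, p.2), ⟨p, hp, by simp [he], rfl⟩, hy⟩
    · exact ⟨p, ⟨p, hp, by simp [he], rfl⟩, hy⟩

theorem BoundaryData.Near.exists_eq_mul {B : BoundaryData G} {P : B.LabelledPartition}
    (hP : ∀ y : G.boundary, ∃ p ∈ P, y ∈ p.1) {ε : ℝ} {f g : G.Point → ℝ} (hf : B.Near P ε f)
    (hg : B.Near P ε g) {y : G.Cpl} (hy : y ∈ G.boundary) :
    ∃ (h : G.Point → ℝ) (a b : ℝ), ∀ x : G.Point,
      (x : G.Cpl) ∈ Metric.ball y ε → f x = a * h x ∧ g x = b * h x := by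
  obtain ⟨⟨A, n⟩, hA, hyA⟩ := hP ⟨y, hy⟩
  have hball : Metric.ball y ε ⊆ nbhd ε A := fun x hx =>
    Metric.mem_thickening_iff.2 ⟨y, ⟨⟨y, hy⟩, hyA, rfl⟩, hx⟩
  cases n using Fin.cases with
  | zero =>
    -- Near a set with label `0` both functions vanish, so the zero function serves as the common
    -- one.
    exact ⟨0, 0, 0, fun x hx => by simp [hf.1 A hA x (hball hx), hg.1 A hA x (hball hx)]⟩
  | succ n =>
    obtain ⟨a, ha⟩ := hf.2 A n hA
    obtain ⟨b, hb⟩ := hg.2 A n hA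
    exact ⟨fun x => B.h n x, a, b, fun x hx => ⟨ha x (hball hx), hb x (hball hx)⟩⟩

theorem BoundaryData.integral_D2_mul_comm [Countable E] [CompactSpace G.Cpl] {B : BoundaryData G}
    {P : B.LabelledPartition} (hP : ∀ y : G.boundary, ∃ p ∈ P, y ∈ p.1) {f g : G.Point → ℝ}
    (hf : f ∈ B.domain P) (hg : g ∈ B.domain P) :
    ∫ x, D2 f x * g x ∂G.vol = ∫ x, f x * D2 g x ∂G.vol := by
  obtain ⟨hf, ε, hε, -, hfn⟩ := hf
  obtain ⟨hg, ε', hε', -, hgn⟩ := hg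
  exact MetricGraph.integral_D2_mul_comm hf hg (lt_min hε hε') fun y hy =>
    (hfn.mono (min_le_left ε ε')).exists_eq_mul hP (hgn.mono (min_le_right ε ε')) hy

theorem isFormalAdjoint_negD2 [Countable E] {D : Submodule ℝ (G.Point → ℝ)}
    {hD : ∀ f ∈ D, IsDmax f} (h : ∀ f ∈ D, ∀ g ∈ D,
      ∫ x, D2 f x * g x ∂G.vol = ∫ x, f x * D2 g x ∂G.vol) :
    (negD2 D hD).IsFormalAdjoint (negD2 D hD) := by
  intro u w
  have hu := LinearPMap.mem_graph _ u
  have hw := LinearPMap.mem_graph _ w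
  rw [graph_negD2] at hu hw
  obtain ⟨f, hf, hf₁, hf₂⟩ := hu
  obtain ⟨g, hg, hg₁, hg₂⟩ := hw
  rw [L2.inner_def, L2.inner_def]
  have e₁ : ∫ x, inner ℝ ((negD2 D hD u : G.L2) x) ((w : G.L2) x) ∂G.vol =
      ∫ x, -(D2 f x * g x) ∂G.vol := by
    refine integral_congr_ae ?_
    filter_upwards [hf₂, hg₁] with x h₁ h₂
    rw [h₁, h₂]
    simp [mul_comm]
  have e₂ : ∫ x, inner ℝ ((u : G.L2) x) ((negD2 D hD w : G.L2) x) ∂G.vol =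
      ∫ x, -(f x * D2 g x) ∂G.vol := by
    refine integral_congr_ae ?_
    filter_upwards [hf₁, hg₂] with x h₁ h₂
    rw [h₁, h₂]
    simp [mul_comm]
  rw [e₁, e₂, integral_neg, integral_neg, h f hf g hg]

/-! ### Test functions on a single edge and density -/

/-- Interior segments of edges keep a positive distance from the boundary. -/
theorem le_dist_of_mem_boundary {e : E} {t c : ℝ} (hc : 0 < c) (ht : c ≤ t)
    (ht' : t ≤ G.len e - c) {y : G.Cpl} (hy : y ∈ G.boundary) :
    c / 2 ≤ dist (G.pt e t : G.Cpl) y := by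
  by_contra! hlt
  -- Graph points within `c / 2` of `G.pt e t` lie in this compact segment. A boundary point that
  -- close would be a limit of such points, hence in the segment, hence an interior point of the
  -- graph.
  have hK : IsClosed ((fun s => (G.pt e s : G.Cpl)) '' Icc (c / 2) (G.len e - c / 2)) := by
    refine (isCompact_Icc.image_of_continuousOn ?_).isClosed
    exact (UniformSpace.Completion.continuous_coe G.Point).comp_continuousOn
      ((continuousOn_pt e).mono (Icc_subset_Icc (by linarith) (by linarith)))
  have hmem : y ∈ Metric.ball (G.pt e t : G.Cpl) (c / 2) := by
    rwa [Metric.mem_ball, dist_comm]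
  have hcl := (UniformSpace.Completion.denseRange_coe (α := G.Point)).open_subset_closure_inter
    Metric.isOpen_ball hmem
  have hsub : Metric.ball (G.pt e t : G.Cpl) (c / 2) ∩ range ((↑) : G.Point → G.Cpl) ⊆
      (fun s => (G.pt e s : G.Cpl)) '' Icc (c / 2) (G.len e - c / 2) := by
    rintro _ ⟨hx, x, rfl⟩
    rw [Metric.mem_ball, UniformSpace.Completion.dist_eq] at hx
    have hle : c ≤ min t (G.len e - t) := le_min ht (by linarith)
    obtain ⟨s, -, hs, rfl⟩ := exists_pt_of_dist_lt (c := c / 2)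
      ⟨by linarith, by linarith⟩ (by linarith) (hx.trans_le (by linarith))
    exact ⟨s, hs, rfl⟩
  obtain ⟨s, hs, rfl⟩ := closure_minimal hsub hK hcl
  refine hy ⟨G.pt e s, fun v _ h => ?_, rfl⟩
  rw [pt_of_mem G ⟨by linarith [hs.1], by linarith [hs.2]⟩] at h
  cases h

theorem memLp_edgeExt {e : E} {g : ℝ → ℝ} (hg : Continuous g)
    (h0 : ∀ t ∉ Ioo 0 (G.len e), g t = 0) : MemLp (edgeExt (G := G) e g) 2 G.vol := by
  have hm : Measurable (edgeExt (G := G) e g) := by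
    intro s hs e'
    change MeasurableSet (comp (edgeExt (G := G) e g) e' ⁻¹' s)
    by_cases he : e' = e
    · subst he
      rw [comp_edgeExt h0]
      exact hg.measurable hs
    · rw [comp_edgeExt_of_ne he]
      exact measurable_const hs
  refine ⟨hm.aestronglyMeasurable, ?_⟩
  rw [eLpNorm_lt_top_iff_lintegral_rpow_enorm_lt_top (by simp) (by simp), vol,
    lintegral_sum_measure]
  have hint : ∀ e', ∫⁻ x, ‖edgeExt (G := G) e g x‖ₑ ^ (2 : ENNReal).toReal
      ∂((volume.restrict (Ioo 0 (G.len e'))).map (G.pt e')) =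
      ∫⁻ t in Ioo 0 (G.len e'), ‖comp (edgeExt (G := G) e g) e' t‖ₑ ^ (2 : ENNReal).toReal :=
    fun e' => lintegral_map (hm.enorm.pow_const _) (measurable_pt e')
  simp only [hint]
  rw [tsum_eq_single e, comp_edgeExt h0]
  · rw [← eLpNorm_lt_top_iff_lintegral_rpow_enorm_lt_top (by simp) (by simp)]
    refine ((hg.memLp_of_hasCompactSupport ?_).restrict _).2
    refine HasCompactSupport.of_support_subset_isCompact (K := Icc 0 (G.len e)) isCompact_Icc
      fun t ht => ?_
    by_contra hne
    exact ht (h0 t fun h => hne (Ioo_subset_Icc_self h))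
  · intro e' he
    simp [comp_edgeExt_of_ne he]

theorem isDmax_edgeExt {e : E} {g : ℝ → ℝ} (hg : ContDiff ℝ 2 g)
    (hs : tsupport g ⊆ Ioo 0 (G.len e)) : IsDmax (edgeExt (G := G) e g) := by
  have h0 : ∀ t ∉ Ioo 0 (G.len e), g t = 0 := fun t ht =>
    image_eq_zero_of_notMem_tsupport fun h => ht (hs h)
  have hs1 : tsupport (deriv g) ⊆ Ioo 0 (G.len e) := (tsupport_deriv_subset).trans hs
  have hs2 : tsupport (deriv (deriv g)) ⊆ Ioo 0 (G.len e) := (tsupport_deriv_subset).trans hs1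
  have h1 : ∀ t ∉ Ioo 0 (G.len e), deriv g t = 0 := fun t ht =>
    image_eq_zero_of_notMem_tsupport fun h => ht (hs1 h)
  have h2 : ∀ t ∉ Ioo 0 (G.len e), deriv (deriv g) t = 0 := fun t ht =>
    image_eq_zero_of_notMem_tsupport fun h => ht (hs2 h)
  have hg1 : ContDiff ℝ 1 (deriv g) := hg.deriv'
  have hd : edgeDeriv (edgeExt (G := G) e g) e = deriv g := by
    funext t
    rw [edgeDeriv, comp_edgeExt h0]
    by_cases ht : t ∈ Icc 0 (G.len e)
    · exact (hg.differentiable (by norm_num) t).derivWithin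
        (uniqueDiffOn_Icc (G.len_pos e) t ht)
    · rw [derivWithin_zero_of_notMem_closure (by rwa [isClosed_Icc.closure_eq]),
        h1 t fun h => ht (Ioo_subset_Icc_self h)]
  have hd' : ∀ e', e' ≠ e → edgeDeriv (edgeExt (G := G) e g) e' = 0 := by
    intro e' he
    rw [← edgeDeriv_zero (G := G) e']
    funext t
    rw [edgeDeriv, comp_edgeExt_of_ne he]
    rfl
  have hD2 : D2 (edgeExt (G := G) e g) = edgeExt e (deriv (deriv g)) := by
    funext x
    cases x with
    | vertex v => rfl
    | inner e' t ht =>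
      simp only [D2, edgeExt]
      split_ifs with he
      · rw [he, hd]
      · rw [hd' e' he]
        exact deriv_const ..
  have hout : ∀ d, outDeriv (edgeExt (G := G) e g) d = 0 := by
    rintro ⟨e', b⟩
    by_cases he : e' = e
    · subst he
      cases b <;> simp [outDeriv, hd, h1]
    · cases b <;> simp [outDeriv, hd' e' he]
  obtain ⟨K, hK⟩ : ∃ K, LipschitzWith K g := by
    refine hg.lipschitzWith_of_hasCompactSupport ?_ (by norm_num)
    exact HasCompactSupport.of_support_subset_isCompact isCompact_Icc
      ((subset_tsupport g).trans (hs.trans Ioo_subset_Icc_self))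
  refine ⟨?_, fun e' => ?_, fun e' => ?_, memLp_edgeExt hg.continuous h0, ?_, fun v _ => ?_⟩
  · refine LipschitzWith.continuous (K := K) (LipschitzWith.of_dist_le_mul fun x y => ?_)
    refine abs_edgeExt_sub_le K.2 h0 (fun s _ t _ => ?_) x y
    simpa [Real.dist_eq] using hK.dist_le_mul s t
  · by_cases he : e' = e
    · subst he
      rw [comp_edgeExt h0]
      exact (hg.differentiable (by norm_num)).differentiableOn
    · rw [comp_edgeExt_of_ne he]
      exact differentiableOn_const 0
  · by_cases he : e' = e
    · subst he
      rw [hd]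
      exact hg1.contDiffOn.absolutelyContinuousOnInterval
    · rw [hd' e' he, ← edgeDeriv_zero (G := G) e']
      exact isDmax_zero.absolutelyContinuous e'
  · rw [hD2]
    exact memLp_edgeExt (hg1.continuous_deriv le_rfl) h2
  · exact Finset.sum_eq_zero fun d _ => hout d

/-- The compact support keeps a positive distance from the boundary, so the function vanishes near
every member of `P`, and the constant `0` works for each label. -/
theorem edgeExt_mem_domain [Countable E] (B : BoundaryData G) (P : B.LabelledPartition) {e : E}
    {g : ℝ → ℝ} (hg : ContDiff ℝ 2 g) (hs : tsupport g ⊆ Ioo 0 (G.len e)) :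
    edgeExt e g ∈ B.domain P := by
  have hcpt : IsCompact (tsupport g) :=
    isCompact_Icc.of_isClosed_subset (isClosed_tsupport g) (hs.trans Ioo_subset_Icc_self)
  obtain ⟨c, hc, hct⟩ : ∃ c > 0, ∀ t ∈ tsupport g, c ≤ t ∧ t ≤ G.len e - c := by
    rcases (tsupport g).eq_empty_or_nonempty with h | h
    · exact ⟨1, one_pos, by simp [h]⟩
    · obtain ⟨a, ha, hmin⟩ := hcpt.exists_isLeast h
      obtain ⟨b, hb, hmax⟩ := hcpt.exists_isGreatest h
      refine ⟨min a (G.len e - b), lt_min (hs ha).1 (sub_pos.2 (hs hb).2), fun t ht =>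
        ⟨(min_le_left ..).trans (hmin ht), ?_⟩⟩
      have := min_le_right a (G.len e - b)
      have := hmax ht
      linarith
  -- The radius `c / 2` comes from `le_dist_of_mem_boundary`; `B.δ / 2` keeps it below `B.δ`.
  have hzero : ∀ A : Set G.boundary, ∀ x : G.Point,
      (x : G.Cpl) ∈ nbhd (min (c / 2) (B.δ / 2)) A → edgeExt e g x = 0 := by
    intro A x hx
    obtain ⟨_, ⟨y, -, rfl⟩, hxy⟩ := Metric.mem_thickening_iff.1 hx
    cases x with
    | vertex v => rfl
    | inner e' t ht =>
      simp only [edgeExt]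
      split_ifs with he
      · subst he
        by_contra hne
        have htc := hct t (subset_tsupport g hne)
        have := le_dist_of_mem_boundary hc htc.1 htc.2 y.2
        rw [pt_of_mem G ht] at this
        exact absurd (hxy.trans_le (min_le_left ..)) (not_lt.2 this)
      · rfl
  exact ⟨isDmax_edgeExt hg hs, _, lt_min (half_pos hc) (half_pos B.δ_pos),
    (min_le_right ..).trans_lt (half_lt_self B.δ_pos), fun A _ => hzero A,
    fun A n _ => ⟨0, fun x hx => by rw [hzero A x hx, zero_mul]⟩⟩

/-- A vector orthogonal to the domain is orthogonal to all test functions on each edge, so it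
vanishes almost everywhere by the fundamental lemma of the calculus of variations. -/
theorem dense_domain_negD2 [Countable E] {D : Submodule ℝ (G.Point → ℝ)}
    {hD : ∀ f ∈ D, IsDmax f} (h : ∀ (e : E) (g : ℝ → ℝ), ContDiff ℝ 2 g →
      tsupport g ⊆ Ioo 0 (G.len e) → edgeExt e g ∈ D) :
    Dense ((negD2 D hD).domain : Set G.L2) := by
  rw [Submodule.dense_iff_topologicalClosure_eq_top, Submodule.topologicalClosure_eq_top_iff,
    Submodule.eq_bot_iff]
  intro u hu
  have hedge : ∀ e, ∀ᵐ t, t ∈ Ioo 0 (G.len e) → comp u e t = 0 := by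
    intro e
    have hmem : MemLp (comp u e) 2 (volume.restrict (Ioo 0 (G.len e))) := by
      have := (Lp.memLp u).mono_measure (Measure.le_sum
        (fun e => (volume.restrict (Ioo 0 (G.len e))).map (G.pt e)) e)
      exact (memLp_map_measure_iff this.1 (measurable_pt e).aemeasurable).1 this
    have hint : IntegrableOn (comp u e) (Ioo 0 (G.len e)) := hmem.integrable one_le_two
    refine isOpen_Ioo.ae_eq_zero_of_integral_contDiff_smul_eq_zero hint.locallyIntegrableOn
      fun g hg _ hs => ?_
    have hg2 : ContDiff ℝ 2 g := contDiff_infty.1 hg 2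
    have hφ := isDmax_edgeExt hg2 hs
    have hgr : (hφ.memLp.toLp _, (hφ.memLp_D2.neg).toLp _) ∈ (negD2 D hD).graph := by
      rw [graph_negD2]
      exact ⟨_, h e g hg2 hs, hφ.memLp.coeFn_toLp, hφ.memLp_D2.neg.coeFn_toLp⟩
    have hin := hu _ (LinearPMap.mem_domain_of_mem_graph hgr)
    rw [L2.inner_def] at hin
    have h0 : ∀ t ∉ Ioo 0 (G.len e), g t = 0 := fun t ht =>
      image_eq_zero_of_notMem_tsupport fun h => ht (hs h)
    have heq : ∫ x, inner ℝ ((hφ.memLp.toLp _ : G.L2) x) (u x) ∂G.vol =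
        ∫ x, (edgeExt (G := G) e g * (u : G.Point → ℝ)) x ∂G.vol := by
      refine integral_congr_ae ?_
      filter_upwards [MemLp.coeFn_toLp hφ.memLp] with x hx
      rw [hx]
      simp [mul_comm]
    rw [heq] at hin
    have hsum := hasSum_integral_edge (hφ.memLp.integrable_mul (Lp.memLp u))
    rw [hin] at hsum
    have hsingle := hasSum_single e (f := fun e' => ∫ t in Ioo 0 (G.len e'),
      comp (edgeExt (G := G) e g * (u : G.Point → ℝ)) e' t) fun e' he => by
        refine setIntegral_eq_zero_of_forall_eq_zero fun t _ => ?_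
        have := congrFun (comp_edgeExt_of_ne (G := G) he g) t
        simp only [comp, Pi.zero_apply] at this
        simp [comp, this]
    -- Only the edge `e` contributes to the inner product, so the integral over `e` is itself zero.
    rw [hsum.unique hsingle, ← setIntegral_eq_integral_of_forall_compl_eq_zero
      (s := Ioo 0 (G.len e)) fun t ht => by simp [h0 t ht]]
    refine setIntegral_congr_fun measurableSet_Ioo fun t ht => ?_
    simp [comp, edgeExt_pt_of_mem ht]
  refine Lp.ext (Filter.EventuallyEq.trans ?_ (Lp.coeFn_zero ..).symm)
  refine ae_vol_of_edges fun e => ?_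
  filter_upwards [hedge e] with t ht ht'
  simpa [comp, pt_of_mem G ht'] using ht ht'

end MetricGraph

/-! ### The operators of the refinement and their union -/

theorem theorem4p2 {V E : Type*} [Countable V] [Countable E] (G : MetricGraph V E)
    [CompactSpace G.Cpl] (htd : IsTotallyDisconnected G.boundary)
    (B : G.BoundaryData) (R : B.Refinement) :
    (∀ j, IsSymmetricOperator (R.S j) ∧ HasSelfAdjointExtension (R.S j)) ∧
      IsSymmetricOperator R.SU ∧ HasSelfAdjointExtension R.SU := by
  have hS : ∀ j, IsSymmetricOperator (R.S j) := fun j =>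
    ⟨MetricGraph.dense_domain_negD2 fun e g => MetricGraph.edgeExt_mem_domain B (R.P j),
      MetricGraph.isFormalAdjoint_negD2 fun f hf g hg =>
        MetricGraph.BoundaryData.integral_D2_mul_comm (R.exists_mem j)
          hf hg⟩
  have hU : IsSymmetricOperator R.SU := by
    refine ⟨MetricGraph.dense_domain_negD2 fun e g hg hs =>
      ⟨0, MetricGraph.edgeExt_mem_domain B (R.P 0) hg hs⟩,
      MetricGraph.isFormalAdjoint_negD2 fun f hf g hg => ?_⟩
    obtain ⟨i, hi⟩ := hf
    obtain ⟨j, hj⟩ := hg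
    have hm : Monotone fun j => B.domain (R.P j) :=
      monotone_nat_of_le_succ fun j => MetricGraph.BoundaryData.domain_le_of_isStep (R.step j)
    exact MetricGraph.BoundaryData.integral_D2_mul_comm
      (R.exists_mem (max i j))
      (hm (le_max_left i j) hi) (hm (le_max_right i j) hj)
  exact ⟨fun j => ⟨hS j, (hS j).hasSelfAdjointExtension⟩, hU, hU.hasSelfAdjointExtension⟩
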